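/- Let $k$ be a field of characteristic zero. Consider standard graded artinian algebras $A=k[x_1,\dots,x_r]/I$, where $I$ is a homogeneous ideal containing no non-zero linear form; then $r=\dim_k A_1$ is the codimension of $A$. Its $h$-vector is $(h_0,h_1,\dots,h_e)$, where $h_i=\dim_k A_i$ and the socle degree $e$ is the last index with $A_e\neq 0$. The socle of $A$ is the annihilator of the ideal generated by the classes of $x_1,\dots,x_r$, and $A$ is Gorenstein if its socle is one-dimensional and concentrated in degree $e$. A vector is called a Gorenstein $h$-vector of codimension $r$ and socle degree $e$ if it is the $h$-vector of such a Gorenstein algebra over $k$. Let $h=(1,h_1,\dots,h_{e-1},1)$ be a Gorenstein $h$-vector of codimension $r$ and socle degree $e$ such that $h_i=\binom{r+i-1}{i}$ for all $0\le i\le \lfloor e/2\rfloor-1$. i) Suppose that $e$ is even, and let $a=h_{e/2}$. Then for every integer $b$ with $a\le b\le \binom{r+e/2-1}{e/2}$, the vector $(1,h_1,\dots,h_{e/2-1},\,b,\,h_{e/2+1},\dots,h_{e-1},1)$ obtained from $h$ by replacing the entry in degree $e/2$ with $b$ is a Gorenstein $h$-vector of codimension $r$ and socle degree $e$. The upper bound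 is sharp: $\binom{r+e/2-1}{e/2}$ is the largest $b$ for which this vector is a Gorenstein $h$-vector of codimension $r$ and socle degree $e$. ii) Suppose that $e$ is odd, and let $a=h_{\lfloor e/2\rfloor}=h_{\lfloor e/2\rfloor+1}$. Then for every integer $b$ with $a\le b\le \binom{r+\lfloor e/2\rfloor-1}{\lfloor e/2\rfloor}$, the vector $(1,h_1,\dots,h_{\lfloor e/2\rfloor-1},\,b,\,b,\,h_{\lfloor e/2\rfloor+2},\dots,h_{e-1},1)$ obtained from $h$ by replacing the entries in degrees $\lfloor e/2\rfloor$ and $\lfloor e/2\rfloor+1$ with $b$ is a Gorenstein $h$-vector of codimension $r$ and socle degree $e$. The upper bound is sharp: $\binom{r+\lfloor e/2\rfloor-1}{\lfloor e/2\rfloor}$ is the largest $b$ for which this vector is a Gorenstein $h$-vector of codimension $r$ and socle degree $e$. -/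

import Mathlib

namespace StdGraded

attribute [local instance] MvPolynomial.gradedAlgebra

/-- The degree `i` component `A_i` of the standard graded algebra `A = k[x_1,...,x_r] / I`:
the image in `A` of the space of forms of degree `i`. -/
noncomputable def component {k : Type*} [Field k] {r : ℕ} (I : Ideal (MvPolynomial (Fin r) k))
    (i : ℕ) : Submodule k (MvPolynomial (Fin r) k ⧸ I) :=
  (MvPolynomial.homogeneousSubmodule (Fin r) k i).map (Ideal.Quotient.mkₐ k I).toLinearMap

/-- The Hilbert function `i ↦ dim_k A_i` of `A = k[x_1,...,x_r] / I`. -/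
noncomputable def hilbertFunction {k : Type*} [Field k] {r : ℕ}
    (I : Ideal (MvPolynomial (Fin r) k)) (i : ℕ) : ℕ :=
  Module.finrank k (component I i)

/-- The ideal of `A = k[x_1,...,x_r] / I` generated by the classes of the variables. -/
noncomputable def irrelevant {k : Type*} [Field k] {r : ℕ} (I : Ideal (MvPolynomial (Fin r) k)) :
    Ideal (MvPolynomial (Fin r) k ⧸ I) :=
  Ideal.span (Set.range fun j : Fin r => Ideal.Quotient.mk I (MvPolynomial.X j))

/-- The socle of `A = k[x_1,...,x_r] / I`: the annihilator of the ideal generated by the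
classes of the variables. -/
noncomputable def socle {k : Type*} [Field k] {r : ℕ} (I : Ideal (MvPolynomial (Fin r) k)) :
    Ideal (MvPolynomial (Fin r) k ⧸ I) :=
  Submodule.annihilator (irrelevant I)

/-- The socle vector `i ↦ dim_k soc(A)_i` of `A = k[x_1,...,x_r] / I`. -/
noncomputable def socleVector {k : Type*} [Field k] {r : ℕ}
    (I : Ideal (MvPolynomial (Fin r) k)) (i : ℕ) : ℕ :=
  Module.finrank k ((socle I).restrictScalars k ⊓ component I i : Submodule k _)

/-- `k[x_1,...,x_r] / I` is a level algebra of codimension `r`, socle degree `e` and type `t`: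
`I` is homogeneous, the quotient is artinian, `dim A_1 = r` (so `I` contains no non-zero linear
form), `e` is the last degree in which `A` is non-zero, and the socle vector is
`(0, ..., 0, t)` with `t` in degree `e`. -/
structure IsLevel {k : Type*} [Field k] {r : ℕ} (I : Ideal (MvPolynomial (Fin r) k))
    (e t : ℕ) : Prop where
  homogeneous : I.IsHomogeneous (MvPolynomial.homogeneousSubmodule (Fin r) k)
  artinian : IsArtinianRing (MvPolynomial (Fin r) k ⧸ I)
  codim : hilbertFunction I 1 = r
  socleDegree : IsGreatest {i : ℕ | 0 < hilbertFunction I i} e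
  socle_eq : ∀ i : ℕ, socleVector I i = if i = e then t else 0

/-- `h = (h 0, ..., h e)`, continued by zero beyond degree `e`, is a Gorenstein `h`-vector over
`k` of codimension `r` and socle degree `e`, i.e. the `h`-vector of a level algebra of type `1`. -/
def IsGorensteinHVector (k : Type*) [Field k] (r e : ℕ) (h : ℕ → ℕ) : Prop :=
  ∃ I : Ideal (MvPolynomial (Fin r) k), IsLevel I e 1 ∧ hilbertFunction I = h

end StdGraded

/-! By Macaulay duality, Gorenstein ideals of socle degree `e` are the ideals `formIdeal φ`, where
`φ ≠ 0` is a functional seeing only forms of degree `e` (`IsConcentrated.isLevel`,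
`IsLevel.exists_eq_formIdeal`). Write `m = e / 2`. To raise the middle by one, replace `φ` by `φ +
ev_x`; dually, this adds a multiple of the `e`-th power of a linear form. If `h m` is not maximal,
some form `p ≠ 0` of degree `m` annihilates `φ`; choose `x` with `p(x) ≠ 0`. In degrees `i ≤ m` the
new ideal is then the old one cut by the condition `f(x) = 0`. Below `m` the old ideal is zero and
nothing changes; in degree `m` exactly one dimension is lost, so the Hilbert function grows by one.
Symmetry settles the degrees above `m`, and iteration reaches every `b` up to the number of
monomials of degree `m`, an obvious upper bound. -/

namespace StdGraded

open MvPolynomial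

attribute [local instance] MvPolynomial.gradedAlgebra

section

variable {k : Type*} [Field k] {r : ℕ}

/-! ### Forms of a fixed degree. -/

instance finite_homogeneousSubmodule (i : ℕ) :
    Module.Finite k (homogeneousSubmodule (Fin r) k i) :=
  Module.Finite.iff_fg.mpr (homogeneousSubmodule_fg (Fin r) k i)

theorem finrank_homogeneousSubmodule (i : ℕ) :
    Module.finrank k (homogeneousSubmodule (Fin r) k i) = (r + i - 1).choose i := by
  classical
  let s : Set (Fin r →₀ ℕ) := {d | d.degree = i}
  have e1 : Sym (Fin r) i ≃ s :=
    (Sym.equivNatSum (Fin r) i).trans (Equiv.setCongr rfl)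
  have : Fintype s := Fintype.ofEquiv _ e1
  rw [homogeneousSubmodule_eq_finsupp_supported]
  rw [(AddMonoidAlgebra.supportedEquivFinsupp (R := k) (S := k) s).finrank_eq,
    Module.finrank_finsupp_self, ← Fintype.card_congr e1, Sym.card_sym_eq_choose,
    Fintype.card_fin]

theorem homogeneousComponent_mul_of_isHomogeneous {f : MvPolynomial (Fin r) k} {i j : ℕ}
    (hf : f.IsHomogeneous i) (g : MvPolynomial (Fin r) k) :
    homogeneousComponent (i + j) (f * g) = f * homogeneousComponent j g := by
  conv_lhs => rw [← sum_homogeneousComponent g, Finset.mul_sum, map_sum]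
  have h : ∀ l, homogeneousComponent (i + j) (f * homogeneousComponent l g) =
      if l = j then f * homogeneousComponent j g else 0 := by
    intro l
    rw [homogeneousComponent_of_mem
      ((mem_homogeneousSubmodule _ _).2 (hf.mul (homogeneousComponent_isHomogeneous l g)))]
    by_cases hl : l = j
    · simp [hl]
    · rw [if_neg (by omega), if_neg hl]
  simp_rw [h, Finset.sum_ite_eq']
  split_ifs with hj
  · rfl
  · rw [homogeneousComponent_eq_zero j g (by simpa using hj), mul_zero]

theorem homogeneousComponent_mul_of_lt {f : MvPolynomial (Fin r) k} {i e : ℕ}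
    (hf : f.IsHomogeneous i) (hi : e < i) (g : MvPolynomial (Fin r) k) :
    homogeneousComponent e (f * g) = 0 := by
  conv_lhs => rw [← sum_homogeneousComponent g, Finset.mul_sum, map_sum]
  refine Finset.sum_eq_zero fun l _ => ?_
  rw [homogeneousComponent_of_mem
      ((mem_homogeneousSubmodule _ _).2 (hf.mul (homogeneousComponent_isHomogeneous l g))),
      if_neg (by omega)]

/-! ### Graded pieces of an ideal and of its quotient. -/

/-- The elements of `I` of degree `i`, as a subspace of the forms of degree `i`. -/
noncomputable def degreePart (I : Ideal (MvPolynomial (Fin r) k)) (i : ℕ) :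
    Submodule k (homogeneousSubmodule (Fin r) k i) :=
  (I.restrictScalars k).comap (homogeneousSubmodule (Fin r) k i).subtype

@[simp] theorem mem_degreePart {I : Ideal (MvPolynomial (Fin r) k)} {i : ℕ}
    {f : homogeneousSubmodule (Fin r) k i} : f ∈ degreePart I i ↔ (f : MvPolynomial _ k) ∈ I :=
  Iff.rfl

theorem hilbertFunction_add_finrank_degreePart (I : Ideal (MvPolynomial (Fin r) k)) (i : ℕ) :
    hilbertFunction I i + Module.finrank k (degreePart I i) = (r + i - 1).choose i := by
  rw [← finrank_homogeneousSubmodule (k := k),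
    ← LinearMap.finrank_range_add_finrank_ker
      ((Ideal.Quotient.mkₐ k I).toLinearMap ∘ₗ (homogeneousSubmodule (Fin r) k i).subtype)]
  have hker : LinearMap.ker ((Ideal.Quotient.mkₐ k I).toLinearMap ∘ₗ
      (homogeneousSubmodule (Fin r) k i).subtype) = degreePart I i := by
    ext f
    simp [Ideal.Quotient.eq_zero_iff_mem]
  rw [hker, hilbertFunction, component, LinearMap.range_comp, Submodule.range_subtype]

instance finite_component (I : Ideal (MvPolynomial (Fin r) k)) (i : ℕ) :
    Module.Finite k (component I i) :=
  Module.Finite.map _ _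

theorem hilbertFunction_eq_zero_iff {I : Ideal (MvPolynomial (Fin r) k)} {i : ℕ} :
    hilbertFunction I i = 0 ↔ ∀ f : MvPolynomial (Fin r) k, f.IsHomogeneous i → f ∈ I := by
  rw [hilbertFunction, Submodule.finrank_eq_zero, component, Submodule.eq_bot_iff]
  simp [Ideal.Quotient.eq_zero_iff_mem]

theorem mk_mem_component {I : Ideal (MvPolynomial (Fin r) k)} {i : ℕ}
    {f : MvPolynomial (Fin r) k} (hf : f.IsHomogeneous i) :
    Ideal.Quotient.mk I f ∈ component I i :=
  ⟨f, hf, rfl⟩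

theorem mk_mem_socle {I : Ideal (MvPolynomial (Fin r) k)} {f : MvPolynomial (Fin r) k} :
    Ideal.Quotient.mk I f ∈ socle I ↔ ∀ j, f * X j ∈ I := by
  rw [socle, irrelevant, Submodule.mem_annihilator_span]
  simp [← map_mul, Ideal.Quotient.eq_zero_iff_mem]

/-! ### From functionals to Gorenstein ideals. -/

/-- The largest ideal contained in the kernel of the functional `φ`. -/
def formIdeal (φ : MvPolynomial (Fin r) k →ₗ[k] k) : Ideal (MvPolynomial (Fin r) k) where
  carrier := {f | ∀ g, φ (f * g) = 0}
  add_mem' ha hb g := by rw [add_mul, map_add, ha g, hb g, add_zero]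
  zero_mem' g := by simp
  smul_mem' c f hf g := by
    rw [smul_eq_mul, mul_comm c, mul_assoc]
    exact hf _

theorem mem_formIdeal {φ : MvPolynomial (Fin r) k →ₗ[k] k} {f : MvPolynomial (Fin r) k} :
    f ∈ formIdeal φ ↔ ∀ g, φ (f * g) = 0 := Iff.rfl

/-- `φ` factors through the projection to the forms of degree `e`. -/
def IsConcentrated (φ : MvPolynomial (Fin r) k →ₗ[k] k) (e : ℕ) : Prop :=
  ∀ f, φ (homogeneousComponent e f) = φ f

namespace IsConcentrated

variable {φ : MvPolynomial (Fin r) k →ₗ[k] k} {e : ℕ}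

theorem mem_of_lt (hφ : IsConcentrated φ e) {f : MvPolynomial (Fin r) k} {i : ℕ}
    (hf : f.IsHomogeneous i) (hi : e < i) : f ∈ formIdeal φ := fun g => by
  rw [← hφ, homogeneousComponent_mul_of_lt hf hi, map_zero]

/-- Only the degree `e` component of `f * g` matters, and it is `f` times the degree `j` component
of `g`. -/
theorem mem_iff (hφ : IsConcentrated φ e) {f : MvPolynomial (Fin r) k} {i j : ℕ}
    (hf : f.IsHomogeneous i) (hij : i + j = e) :
    f ∈ formIdeal φ ↔ ∀ g : MvPolynomial (Fin r) k, g.IsHomogeneous j → φ (f * g) = 0 := by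
  refine ⟨fun h g _ => h g, fun h g => ?_⟩
  rw [← hφ, ← hij, homogeneousComponent_mul_of_isHomogeneous hf]
  exact h _ (homogeneousComponent_isHomogeneous _ _)

theorem homogeneousComponent_mem (hφ : IsConcentrated φ e) {f : MvPolynomial (Fin r) k}
    (hf : f ∈ formIdeal φ) (i : ℕ) : homogeneousComponent i f ∈ formIdeal φ := by
  rcases lt_or_ge e i with hi | hi
  · exact hφ.mem_of_lt (homogeneousComponent_isHomogeneous i f) hi
  obtain ⟨j, rfl⟩ := Nat.exists_eq_add_of_le hi
  rw [hφ.mem_iff (homogeneousComponent_isHomogeneous i f) rfl]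
  intro g hg
  rw [mul_comm, ← homogeneousComponent_mul_of_isHomogeneous hg, add_comm, hφ, mul_comm]
  exact hf g

theorem isHomogeneous (hφ : IsConcentrated φ e) :
    (formIdeal φ).IsHomogeneous (homogeneousSubmodule (Fin r) k) := by
  intro i f hf
  have h : ((DirectSum.decompose (homogeneousSubmodule (Fin r) k) f i :
      homogeneousSubmodule (Fin r) k i) : MvPolynomial (Fin r) k) = homogeneousComponent i f :=
    decomposition.decompose'_apply f i
  rw [h]
  exact hφ.homogeneousComponent_mem hf i

/-- The pairing of forms of degrees `i` and `j` given by multiplication and `φ`. -/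
noncomputable def _root_.StdGraded.pairing (φ : MvPolynomial (Fin r) k →ₗ[k] k) (i j : ℕ) :
    homogeneousSubmodule (Fin r) k i →ₗ[k] homogeneousSubmodule (Fin r) k j →ₗ[k] k :=
  ((LinearMap.mul k (MvPolynomial (Fin r) k)).compr₂ φ).domRestrict₁₂ _ _

theorem finrank_range_pairing (hφ : IsConcentrated φ e) {i j : ℕ} (hij : i + j = e) :
    Module.finrank k (LinearMap.range (pairing φ i j)) = hilbertFunction (formIdeal φ) i := by
  have h1 := LinearMap.finrank_range_add_finrank_ker (pairing φ i j)
  have h2 := hilbertFunction_add_finrank_degreePart (formIdeal φ) i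
  have h3 : LinearMap.ker (pairing φ i j) = degreePart (formIdeal φ) i := by
    ext f
    rw [mem_degreePart, hφ.mem_iff f.2 hij, LinearMap.mem_ker, LinearMap.ext_iff]
    exact ⟨fun h g hg => h ⟨g, hg⟩, fun h g => h g g.2⟩
  rw [h3, finrank_homogeneousSubmodule] at h1
  omega

theorem _root_.LinearMap.finrank_range_flip {K V W : Type*} [Field K] [AddCommGroup V]
    [Module K V] [AddCommGroup W] [Module K W] [FiniteDimensional K W] [FiniteDimensional K V]
    (B : V →ₗ[K] W →ₗ[K] K) :
    Module.finrank K (LinearMap.range B.flip) = Module.finrank K (LinearMap.range B) := by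
  have h : B.flip = B.dualMap ∘ₗ (Module.evalEquiv K W).toLinearMap := by
    ext; simp
  rw [h, LinearMap.range_comp_of_range_eq_top _ (LinearEquiv.range _),
    LinearMap.finrank_range_dualMap_eq_finrank_range]

/-- Both sides are the rank of the same bilinear pairing, read from its two arguments. -/
theorem hilbertFunction_symm (hφ : IsConcentrated φ e) {i j : ℕ} (hij : i + j = e) :
    hilbertFunction (formIdeal φ) i = hilbertFunction (formIdeal φ) j := by
  rw [← hφ.finrank_range_pairing hij, ← hφ.finrank_range_pairing ((add_comm j i).trans hij),
    ← LinearMap.finrank_range_flip]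
  have h : (pairing φ i j).flip = pairing φ j i :=
    LinearMap.ext₂ fun f g => congrArg φ (mul_comm (g : MvPolynomial (Fin r) k) f)
  rw [h]

theorem hilbertFunction_of_lt (hφ : IsConcentrated φ e) {i : ℕ} (hi : e < i) :
    hilbertFunction (formIdeal φ) i = 0 :=
  hilbertFunction_eq_zero_iff.2 fun _ hf => hφ.mem_of_lt hf hi

theorem _root_.StdGraded.hilbertFunction_formIdeal_zero (h0 : φ ≠ 0) :
    hilbertFunction (formIdeal φ) 0 = 1 := by
  have h2 := hilbertFunction_add_finrank_degreePart (formIdeal φ) 0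
  have h3 : degreePart (formIdeal φ) 0 = ⊥ := by
    refine (Submodule.eq_bot_iff _).2 fun ⟨f, hf⟩ hfI => ?_
    rw [homogeneousSubmodule_zero, Submodule.mem_one] at hf
    obtain ⟨c, rfl⟩ := hf
    by_contra hne
    have hc : c ≠ 0 := by
      rintro rfl
      exact hne (by simp)
    refine h0 (LinearMap.ext fun g => ?_)
    have : φ (C c * (C c⁻¹ * g)) = 0 := hfI (C c⁻¹ * g)
    rwa [← mul_assoc, ← C_mul, mul_inv_cancel₀ hc, C_1, one_mul] at this
  rw [h3, finrank_bot] at h2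
  simpa using h2

theorem finite_quotient (hφ : IsConcentrated φ e) :
    Module.Finite k (MvPolynomial (Fin r) k ⧸ formIdeal φ) := by
  refine Module.Finite.of_surjective ((Ideal.Quotient.mkₐ k (formIdeal φ)).toLinearMap ∘ₗ
    (restrictTotalDegree (Fin r) k e).subtype) (LinearMap.range_eq_top.1 (eq_top_iff.2 ?_))
  rintro x -
  obtain ⟨f, rfl⟩ := Ideal.Quotient.mk_surjective x
  rw [← sum_homogeneousComponent f, map_sum]
  refine Submodule.sum_mem _ fun i _ => ?_
  rcases lt_or_ge e i with hi | hi
  · rw [Ideal.Quotient.eq_zero_iff_mem.2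
      (hφ.mem_of_lt (homogeneousComponent_isHomogeneous i f) hi)]
    exact zero_mem _
  · exact ⟨⟨homogeneousComponent i f, (mem_restrictTotalDegree _ _ _).2
      ((homogeneousComponent_isHomogeneous i f).totalDegree_le.trans hi)⟩, rfl⟩

/-- This confines the socle to degree `e`: for `i < e` the test forms `g` have positive degree,
hence lie in the ideal of the variables, which multiplies `f` into `formIdeal φ`. -/
theorem mem_of_mul_X_mem (hφ : IsConcentrated φ e) {f : MvPolynomial (Fin r) k} {i : ℕ}
    (hf : f.IsHomogeneous i) (hi : i ≠ e) (hX : ∀ j, f * X j ∈ formIdeal φ) :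
    f ∈ formIdeal φ := by
  rcases lt_or_gt_of_ne hi with hi | hi
  · obtain ⟨j, rfl⟩ := Nat.exists_eq_add_of_lt hi
    rw [hφ.mem_iff (j := j + 1) hf (by omega)]
    intro g hg
    have hspan : g ∈ Ideal.span (Set.range (X : Fin r → MvPolynomial (Fin r) k)) := by
      rw [← Set.image_univ, mem_ideal_span_X_image]
      intro d hd
      by_contra! h
      have : d = 0 := Finsupp.ext fun a => h a (Set.mem_univ a)
      have h1 := hg.degree_eq_sum_deg_support hd
      simp [this] at h1
    have : f * g ∈ formIdeal φ := by
      clear hg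
      induction hspan using Submodule.span_induction with
      | mem x hx => obtain ⟨a, rfl⟩ := hx; exact hX a
      | zero => simp
      | add x y _ _ hx hy => rw [mul_add]; exact add_mem hx hy
      | smul c x _ hx => rw [smul_eq_mul, mul_left_comm]; exact Ideal.mul_mem_left _ _ hx
    simpa using this 1
  · exact hφ.mem_of_lt hf hi

theorem isLevel (hφ : IsConcentrated φ e) (h0 : φ ≠ 0)
    (hr : hilbertFunction (formIdeal φ) 1 = r) : IsLevel (formIdeal φ) e 1 := by
  have hone : hilbertFunction (formIdeal φ) e = 1 := by
    rw [← hφ.hilbertFunction_symm (zero_add e), hilbertFunction_formIdeal_zero h0]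
  refine ⟨hφ.isHomogeneous, ?_, hr, ⟨by simp [hone], fun i hi => ?_⟩, fun i => ?_⟩
  · have := hφ.finite_quotient
    exact IsArtinianRing.of_finite k _
  · by_contra! hlt
    exact absurd (hφ.hilbertFunction_of_lt hlt) (Nat.pos_iff_ne_zero.1 hi)
  · split_ifs with hi
    · subst hi
      rw [← hone, socleVector, hilbertFunction]
      rw [inf_eq_right.2]
      rintro _ ⟨f, hf, rfl⟩
      exact mk_mem_socle.2 fun j => hφ.mem_of_lt (IsHomogeneous.mul hf (isHomogeneous_X k j))
        (Nat.lt_succ_self _)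
    · have hbot : ((socle (formIdeal φ)).restrictScalars k ⊓ component (formIdeal φ) i :
          Submodule k _) = ⊥ := by
        rw [Submodule.eq_bot_iff]
        rintro _ ⟨hx, f, hf, rfl⟩
        exact Ideal.Quotient.eq_zero_iff_mem.2
          (hφ.mem_of_mul_X_mem hf hi (mk_mem_socle.1 hx))
      rw [socleVector, hbot, finrank_bot]

end IsConcentrated

/-! ### From Gorenstein ideals to functionals. -/

/-- The degree `e` piece of the quotient is all socle, hence a line; `φ` is projection to it
followed by a functional that is non-zero there. Since the socle vanishes in other degrees,
membership in `I` can be tested after multiplying up to degree `e`. -/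
theorem IsLevel.exists_eq_formIdeal {I : Ideal (MvPolynomial (Fin r) k)} {e : ℕ}
    (hI : IsLevel I e 1) :
    ∃ φ : MvPolynomial (Fin r) k →ₗ[k] k, IsConcentrated φ e ∧ φ ≠ 0 ∧ I = formIdeal φ := by
  have hgt : ∀ {i : ℕ} {f : MvPolynomial (Fin r) k}, f.IsHomogeneous i → e < i → f ∈ I := by
    intro i f hf hi
    refine hilbertFunction_eq_zero_iff.1 ?_ f hf
    by_contra h
    exact absurd (hI.socleDegree.2 (Nat.pos_of_ne_zero h)) (not_le.2 hi)
  have hsoc : ∀ {i : ℕ} {f : MvPolynomial (Fin r) k}, f.IsHomogeneous i → i ≠ e →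
      (∀ j, f * X j ∈ I) → f ∈ I := by
    intro i f hf hi hX
    have h0 := hI.socle_eq i
    rw [if_neg hi, socleVector] at h0
    have : FiniteDimensional k
        ((socle I).restrictScalars k ⊓ component I i : Submodule k _) :=
      Submodule.finiteDimensional_of_le inf_le_right
    have h1 := Submodule.finrank_eq_zero.1 h0
    rw [Submodule.eq_bot_iff] at h1
    exact Ideal.Quotient.eq_zero_iff_mem.1 (h1 _ ⟨mk_mem_socle.2 hX, mk_mem_component hf⟩)
  have hone : Module.finrank k (component I e) = 1 := by
    have h0 := hI.socle_eq e
    rwa [if_pos rfl, socleVector, inf_eq_right.2] at h0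
    rintro _ ⟨f, hf, rfl⟩
    exact mk_mem_socle.2 fun j => hgt (IsHomogeneous.mul hf (isHomogeneous_X k j))
      (Nat.lt_succ_self _)
  obtain ⟨v, hv, hspan⟩ := finrank_eq_one_iff'.1 hone
  obtain ⟨ψ, hψ⟩ : ∃ ψ : Module.Dual k (MvPolynomial (Fin r) k ⧸ I), ψ v ≠ 0 := by
    by_contra! h
    exact hv (Subtype.ext ((Module.forall_dual_apply_eq_zero_iff k _).1 h))
  let φ : MvPolynomial (Fin r) k →ₗ[k] k :=
    ψ ∘ₗ (Ideal.Quotient.mkₐ k I).toLinearMap ∘ₗ homogeneousComponent e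
  have hφe : ∀ f : MvPolynomial (Fin r) k, f.IsHomogeneous e →
      φ f = ψ (Ideal.Quotient.mk I f) := fun f hf =>
    congrArg (fun g => ψ (Ideal.Quotient.mk I g)) (homogeneousComponent_eq_self hf)
  have hφ : IsConcentrated φ e := fun f => hφe _ (homogeneousComponent_isHomogeneous e f)
  have htop : ∀ f : MvPolynomial (Fin r) k, f.IsHomogeneous e → φ f = 0 → f ∈ I := by
    intro f hf h0
    obtain ⟨c, hc⟩ := hspan ⟨_, mk_mem_component hf⟩
    have hc' : c • (v : MvPolynomial (Fin r) k ⧸ I) = Ideal.Quotient.mk I f :=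
      congrArg Subtype.val hc
    rw [hφe f hf, ← hc', map_smul, smul_eq_mul, mul_eq_zero, or_iff_left hψ] at h0
    rw [h0, zero_smul] at hc'
    exact Ideal.Quotient.eq_zero_iff_mem.1 hc'.symm
  have hle : I ≤ formIdeal φ := by
    intro f hf g
    have h1 : homogeneousComponent e (f * g) ∈ I :=
      homogeneousComponent_mem_of_mem hI.homogeneous (I.mul_mem_right g hf) e
    change ψ (Ideal.Quotient.mk I (homogeneousComponent e (f * g))) = 0
    rw [Ideal.Quotient.eq_zero_iff_mem.2 h1, map_zero]
  -- Descending induction on the degree: `n` bounds the distance from `i` up to `e`.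
  have hge : ∀ (n i : ℕ) (f : MvPolynomial (Fin r) k), e ≤ i + n → f.IsHomogeneous i →
      f ∈ formIdeal φ → f ∈ I := by
    intro n
    induction n with
    | zero =>
      intro i f hi hf hfφ
      rcases hi.lt_or_eq with h | rfl
      · exact hgt hf h
      · exact htop f hf (by simpa using hfφ 1)
    | succ n ih =>
      intro i f hi hf hfφ
      by_cases hie : i = e
      · subst hie
        exact htop f hf (by simpa using hfφ 1)
      · exact hsoc hf hie fun j => ih (i + 1) _ (by omega) (hf.mul (isHomogeneous_X k j))
          (Ideal.mul_mem_right _ _ hfφ)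
  refine ⟨φ, hφ, ?_, le_antisymm hle fun f hf => ?_⟩
  · intro h0
    have h1 : hilbertFunction I e = 0 :=
      hilbertFunction_eq_zero_iff.2 fun f hf => htop f hf (by rw [h0, LinearMap.zero_apply])
    rw [hilbertFunction, hone] at h1
    exact one_ne_zero h1
  · rw [← sum_homogeneousComponent f]
    exact I.sum_mem fun i _ => hge e i _ (Nat.le_add_left _ _)
      (homogeneousComponent_isHomogeneous i f) (hφ.homogeneousComponent_mem hf i)

/-! ### Adding a point evaluation. -/

/-- Evaluation at the point `x` of the component of degree `e`. -/
noncomputable def evalComponent (x : Fin r → k) (e : ℕ) : MvPolynomial (Fin r) k →ₗ[k] k :=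
  (aeval x).toLinearMap ∘ₗ homogeneousComponent e

theorem evalComponent_of_isHomogeneous (x : Fin r → k) {e : ℕ} {f : MvPolynomial (Fin r) k}
    (hf : f.IsHomogeneous e) : evalComponent x e f = eval x f := by
  rw [evalComponent, LinearMap.comp_apply, homogeneousComponent_eq_self hf,
    AlgHom.toLinearMap_apply, aeval_eq_eval]

theorem isConcentrated_evalComponent (x : Fin r → k) (e : ℕ) :
    IsConcentrated (evalComponent x e) e := fun f =>
  congrArg (aeval x) (homogeneousComponent_eq_self (homogeneousComponent_isHomogeneous e f))

theorem IsConcentrated.add {φ ψ : MvPolynomial (Fin r) k →ₗ[k] k} {e : ℕ}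
    (hφ : IsConcentrated φ e) (hψ : IsConcentrated ψ e) : IsConcentrated (φ + ψ) e := fun f => by
  rw [LinearMap.add_apply, LinearMap.add_apply, hφ, hψ]

/-- If some form of complementary degree annihilating `φ` does not vanish at `x`, then the
annihilator of `φ + ev_x` consists of the elements of the annihilator of `φ` vanishing at `x`. -/
theorem IsConcentrated.mem_formIdeal_add_evalComponent {φ : MvPolynomial (Fin r) k →ₗ[k] k}
    {i j : ℕ} (hφ : IsConcentrated φ (i + j)) {x : Fin r → k} {q : MvPolynomial (Fin r) k}
    (hq : q.IsHomogeneous j) (hqφ : q ∈ formIdeal φ) (hqx : eval x q ≠ 0)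
    {f : MvPolynomial (Fin r) k} (hf : f.IsHomogeneous i) :
    f ∈ formIdeal (φ + evalComponent x (i + j)) ↔ f ∈ formIdeal φ ∧ eval x f = 0 := by
  rw [(hφ.add (isConcentrated_evalComponent x _)).mem_iff hf rfl, hφ.mem_iff hf rfl]
  have key : ∀ g : MvPolynomial (Fin r) k, g.IsHomogeneous j →
      (φ + evalComponent x (i + j)) (f * g) = φ (f * g) + eval x f * eval x g := fun g hg => by
    rw [LinearMap.add_apply, evalComponent_of_isHomogeneous x (hf.mul hg), map_mul (eval x)]
  constructor
  · intro h
    have hfx : eval x f = 0 := by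
      -- Testing against `q` kills the `φ` term and leaves `f(x) q(x) = 0`.
      have h1 := h q hq
      rw [key q hq, mul_comm f, hqφ f, zero_add, mul_eq_zero] at h1
      exact h1.resolve_right hqx
    refine ⟨fun g hg => ?_, hfx⟩
    simpa [key g hg, hfx] using h g hg
  · rintro ⟨h, hfx⟩ g hg
    rw [key g hg, h g hg, hfx, zero_mul, add_zero]

theorem finrank_inf_ker_add_one {V : Type*} [AddCommGroup V] [Module k V] [FiniteDimensional k V]
    {W W' : Submodule k V} {l : V →ₗ[k] k} (hW' : ∀ v, v ∈ W' ↔ v ∈ W ∧ l v = 0) {w : V}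
    (hw : w ∈ W) (hlw : l w ≠ 0) : Module.finrank k W' + 1 = Module.finrank k W := by
  have h := LinearMap.finrank_range_add_finrank_ker (l.domRestrict W)
  have hr : LinearMap.range (l.domRestrict W) = ⊤ := by
    refine LinearMap.range_eq_top.2 (LinearMap.surjective_of_ne_zero fun h0 => hlw ?_)
    exact LinearMap.congr_fun h0 ⟨w, hw⟩
  have hk : (LinearMap.ker (l.domRestrict W)).map W.subtype = W' := by
    ext v
    rw [hW']
    constructor
    · rintro ⟨u, hu, rfl⟩
      exact ⟨u.2, hu⟩
    · rintro ⟨hv, hv0⟩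
      exact ⟨⟨v, hv⟩, hv0, rfl⟩
  rw [← hk, Submodule.finrank_map_subtype_eq, ← h, hr, finrank_top, Module.finrank_self, add_comm]

/-! ### Raising the middle entries. -/

/-- Raising the middle of a Gorenstein `h`-vector by one. -/
theorem IsGorensteinHVector.succ_middle [CharZero k] {e : ℕ} {h : ℕ → ℕ}
    (hGor : IsGorensteinHVector k r e h)
    (hmax : ∀ i < e / 2, h i = (r + i - 1).choose i)
    (hlt : h (e / 2) < (r + e / 2 - 1).choose (e / 2)) :
    IsGorensteinHVector k r e
      (fun i => if i = e / 2 ∨ i = e - e / 2 then h (e / 2) + 1 else h i) := by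
  obtain ⟨I, hI, rfl⟩ := hGor
  have hr := hI.codim
  obtain ⟨φ, hφ, h0, rfl⟩ := hI.exists_eq_formIdeal
  clear hI
  have hzero := hilbertFunction_formIdeal_zero h0
  -- The entries `1` and `r` in degrees 0 and 1 are already maximal, so `e / 2 ≥ 2`; hence the
  -- modification leaves these two degrees alone.
  have hm0 : e / 2 ≠ 0 := by
    intro hm
    rw [hm, hzero] at hlt
    simp at hlt
  have hm1 : e / 2 ≠ 1 := by
    intro hm
    rw [hm, hr] at hlt
    simp at hlt
  set m := e / 2 with hm
  -- a form of degree `m` annihilating `φ`, and a point where it does not vanish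
  have hdim := hilbertFunction_add_finrank_degreePart (formIdeal φ) m
  obtain ⟨p, hpI, hp0⟩ := (degreePart (formIdeal φ) m).ne_bot_iff.1 (by
    intro hbot
    rw [hbot, finrank_bot] at hdim
    omega)
  have hrpos : 0 < r := by
    rcases Nat.eq_zero_or_pos r with rfl | h
    · rw [Nat.choose_eq_zero_of_lt (by omega)] at hlt
      omega
    · exact h
  let j : Fin r := ⟨0, hrpos⟩
  -- Characteristic zero makes `k` infinite, so a non-zero polynomial has a non-zero value. The
  -- factor `X j` forces `x j ≠ 0`, so that every `p * X j ^ d` is also non-zero at `x`.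
  obtain ⟨x, hx⟩ : ∃ x, eval x ((p : MvPolynomial (Fin r) k) * X j) ≠ 0 := by
    by_contra! hall
    have : (p : MvPolynomial (Fin r) k) * X j = 0 :=
      MvPolynomial.funext fun x => by rw [hall, map_zero]
    exact (mul_ne_zero (fun hp => hp0 (Subtype.ext hp)) (X_ne_zero j)) this
  rw [map_mul, eval_X] at hx
  have hpx := left_ne_zero_of_mul hx
  have hxj := right_ne_zero_of_mul hx
  have hmem : ∀ i ≤ m, ∀ f : MvPolynomial (Fin r) k, f.IsHomogeneous i →
      (f ∈ formIdeal (φ + evalComponent x e) ↔ f ∈ formIdeal φ ∧ eval x f = 0) := by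
    intro i hi f hf
    -- The test form must have degree `e - i`, which is at least `m` because `i ≤ m = e / 2`; `X j ^
    -- d` fills the gap.
    obtain ⟨d, hd⟩ : ∃ d, e = i + (m + d) := ⟨e - i - m, by omega⟩
    have hφ' := hφ
    rw [hd] at hφ' ⊢
    refine hφ'.mem_formIdeal_add_evalComponent (q := (p : MvPolynomial (Fin r) k) * X j ^ d)
      (IsHomogeneous.mul p.2 (isHomogeneous_X_pow j d)) (Ideal.mul_mem_right _ _ hpI) ?_ hf
    rw [map_mul, map_pow, eval_X]
    exact mul_ne_zero hpx (pow_ne_zero _ hxj)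
  have hψ := hφ.add (isConcentrated_evalComponent x e)
  set ψ := φ + evalComponent x e
  have hlow : ∀ i < m, hilbertFunction (formIdeal ψ) i = hilbertFunction (formIdeal φ) i := by
    intro i hi
    have h1 := hilbertFunction_add_finrank_degreePart (formIdeal φ) i
    have h2 := hilbertFunction_add_finrank_degreePart (formIdeal ψ) i
    have h3 : degreePart (formIdeal ψ) i ≤ degreePart (formIdeal φ) i := fun f hf =>
      ((hmem i hi.le f f.2).1 hf).1
    have h4 := Submodule.finrank_mono h3
    -- Maximality says that the old ideal is zero in degree `i`, hence so is the new one.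
    have h5 := hmax i hi
    omega
  have hmid : hilbertFunction (formIdeal ψ) m = hilbertFunction (formIdeal φ) m + 1 := by
    have h2 := hilbertFunction_add_finrank_degreePart (formIdeal ψ) m
    have h3 := finrank_inf_ker_add_one (W := degreePart (formIdeal φ) m)
      (W' := degreePart (formIdeal ψ) m)
      (l := (aeval x).toLinearMap ∘ₗ (homogeneousSubmodule (Fin r) k m).subtype)
      (fun f => hmem m le_rfl f f.2) hpI hpx
    omega
  have hfun : hilbertFunction (formIdeal ψ) = fun i => if i = m ∨ i = e - m then
      hilbertFunction (formIdeal φ) m + 1 else hilbertFunction (formIdeal φ) i := by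
    have hle : ∀ i ≤ m, hilbertFunction (formIdeal ψ) i = if i = m then
        hilbertFunction (formIdeal φ) m + 1 else hilbertFunction (formIdeal φ) i := by
      intro i hi
      split_ifs with him
      · rw [him, hmid]
      · exact hlow i (by omega)
    funext i
    rcases le_or_gt i m with hi | hi
    · rw [hle i hi]
      congr 1
      exact propext (by omega)
    rcases lt_or_ge e i with hei | hei
    · rw [if_neg (by omega), hφ.hilbertFunction_of_lt hei, hψ.hilbertFunction_of_lt hei]
    -- Since `e ≤ 2 * m + 1`, a degree `i > m` reflects to `e - i ≤ m`.
    · have hij : i + (e - i) = e := by omega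
      rw [hψ.hilbertFunction_symm hij, hφ.hilbertFunction_symm hij, hle _ (by omega)]
      congr 1
      exact propext (by omega)
  have hcodim : hilbertFunction (formIdeal ψ) 1 = r := by
    rw [hlow 1 (by omega), hr]
  refine ⟨formIdeal ψ, hψ.isLevel ?_ hcodim, hfun⟩
  -- If `ψ = 0`, its ideal is everything, contradicting the value 1 in degree 0.
  intro hψ0
  have h1 := hlow 0 (by omega)
  rw [hzero, hilbertFunction_eq_zero_iff.2] at h1
  · omega
  · intro f _ g
    rw [hψ0, LinearMap.zero_apply]

theorem IsGorensteinHVector.apply_le {e : ℕ} {h : ℕ → ℕ} (hGor : IsGorensteinHVector k r e h)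
    (i : ℕ) : h i ≤ (r + i - 1).choose i := by
  obtain ⟨I, -, rfl⟩ := hGor
  exact (Nat.le_add_right _ _).trans_eq (hilbertFunction_add_finrank_degreePart I i)

theorem IsGorensteinHVector.symm {e : ℕ} {h : ℕ → ℕ} (hGor : IsGorensteinHVector k r e h)
    {i j : ℕ} (hij : i + j = e) : h i = h j := by
  obtain ⟨I, hI, rfl⟩ := hGor
  obtain ⟨φ, hφ, -, rfl⟩ := hI.exists_eq_formIdeal
  exact hφ.hilbertFunction_symm hij

/-- The middle of a Gorenstein `h`-vector that is maximal below it can be raised to any value up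
to the maximal one. -/
theorem IsGorensteinHVector.replace_middle [CharZero k] {e : ℕ} {h : ℕ → ℕ}
    (hGor : IsGorensteinHVector k r e h)
    (hmax : ∀ i < e / 2, h i = (r + i - 1).choose i) {b : ℕ} (hb : h (e / 2) ≤ b)
    (hb' : b ≤ (r + e / 2 - 1).choose (e / 2)) :
    IsGorensteinHVector k r e (fun i => if i = e / 2 ∨ i = e - e / 2 then b else h i) := by
  induction b, hb using Nat.le_induction with
  | base =>
    convert hGor using 2 with i
    -- The two middle entries already agree by symmetry, so writing `h (e / 2)` in both changes
    -- nothing.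
    have := hGor.symm (i := e / 2) (j := e - e / 2) (by omega)
    grind
  | succ b _ ih =>
    have hstep := (ih (by omega)).succ_middle
      (fun i hi => by rw [if_neg (by omega), hmax i hi])
      (by rw [if_pos (Or.inl rfl)]; omega)
    convert hstep using 2 with i
    grind

end

end StdGraded

theorem theorem2p3 (k : Type*) [Field k] [CharZero k] (r e : ℕ) (h : ℕ → ℕ) (a : ℕ)
    (hGor : StdGraded.IsGorensteinHVector k r e h)
    (hmax : ∀ i : ℕ, i < e / 2 → h i = Nat.choose (r + i - 1) i) :
    (Even e → h (e / 2) = a →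
      (∀ b : ℕ, a ≤ b → b ≤ Nat.choose (r + e / 2 - 1) (e / 2) →
        StdGraded.IsGorensteinHVector k r e (Function.update h (e / 2) b)) ∧
      IsGreatest
        {b : ℕ | StdGraded.IsGorensteinHVector k r e (Function.update h (e / 2) b)}
        (Nat.choose (r + e / 2 - 1) (e / 2))) ∧
    (Odd e → h (e / 2) = a → h (e / 2 + 1) = a →
      (∀ b : ℕ, a ≤ b → b ≤ Nat.choose (r + e / 2 - 1) (e / 2) →
        StdGraded.IsGorensteinHVector k r e
          (Function.update (Function.update h (e / 2) b) (e / 2 + 1) b)) ∧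
      IsGreatest
        {b : ℕ | StdGraded.IsGorensteinHVector k r e
          (Function.update (Function.update h (e / 2) b) (e / 2 + 1) b)}
        (Nat.choose (r + e / 2 - 1) (e / 2))) := by
  refine ⟨fun he ha => ?_, fun he ha _ => ?_⟩
  · have key : ∀ b : ℕ, a ≤ b → b ≤ Nat.choose (r + e / 2 - 1) (e / 2) →
        StdGraded.IsGorensteinHVector k r e (Function.update h (e / 2) b) := by
      intro b hab hb
      convert hGor.replace_middle hmax (ha.trans_le hab) hb using 1
      funext i
      -- For even `e` the two middle degrees coincide; for odd `e` they are consecutive.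
      have : e - e / 2 = e / 2 := by grind
      simp [Function.update_apply, this]
    refine ⟨key, key _ (ha ▸ hGor.apply_le _) le_rfl, fun b hb => ?_⟩
    simpa using StdGraded.IsGorensteinHVector.apply_le hb (e / 2)
  · have key : ∀ b : ℕ, a ≤ b → b ≤ Nat.choose (r + e / 2 - 1) (e / 2) →
        StdGraded.IsGorensteinHVector k r e
          (Function.update (Function.update h (e / 2) b) (e / 2 + 1) b) := by
      intro b hab hb
      convert hGor.replace_middle hmax (ha.trans_le hab) hb using 1
      funext i
      have : e - e / 2 = e / 2 + 1 := by grind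
      rw [this, Function.update_apply, Function.update_apply]
      grind
    refine ⟨key, key _ (ha ▸ hGor.apply_le _) le_rfl, fun b hb => ?_⟩
    simpa using StdGraded.IsGorensteinHVector.apply_le hb (e / 2)
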